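/- Let $n, m \ge 1$ be integers. A function $f : \mathbb{Z}/n\mathbb{Z} \to \mathbb{Z}/m\mathbb{Z}$ is called congruence preserving if for every divisor $d$ of $m$ and all $a, b \in \{0, \dots, n-1\}$, $a \equiv b \pmod d$ implies $f(a) \equiv f(b) \pmod d$. Let $CP(n,m)$ be the number of congruence preserving functions $\mathbb{Z}/n\mathbb{Z} \to \mathbb{Z}/m\mathbb{Z}$. Let $m = p_1^{e_1} \cdots p_r^{e_r}$ be the prime factorization of $m$ and let $\mu(m) = \max_i p_i^{e_i}$ be the largest prime power dividing $m$ (with $\mu(1) = 1$). Then: 1. $CP(n,m) = \prod_{i=1}^{r} CP(n, p_i^{e_i})$. 2. For every prime $p$ and every integer $e \ge 0$, $$CP(n,p^e) = \begin{cases} p^{\,p+p^2+\dots+p^e} & \text{if } n \ge p^e,\\ p^{\,p+p^2+\dots+p^l+(e-l)n} & \text{if } n < p^e, \text{ where } l = \lfloor \log_p n \rfloor. \end{cases}$$ 3. If $n \ge \mu(m)$, then $$CP(n,m) = \prod_{i=1}^{r} p_i^{\,p_i+p_i^2+\dots+p_i^{e_i}}.$$ 4. If $n < \mu(m)$, then,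 with $l_i = \lfloor \log_{p_i} n \rfloor$, $$CP(n,m) = \prod_{i \,:\, p_i^{e_i} \le n} p_i^{\,p_i+p_i^2+\dots+p_i^{e_i}} \;\times \prod_{i \,:\, p_i^{e_i} > n} p_i^{\,p_i+p_i^2+\dots+p_i^{l_i}+(e_i-l_i)n}.$$ (Empty sums are $0$ and empty products are $1$.) -/

import Mathlib

/-- A function `f : ℤ/nℤ → ℤ/mℤ` is congruence preserving if, for every divisor `d` of `m` and all
`a, b ∈ {0, …, n - 1}`, `a ≡ b (mod d)` implies `f(a) ≡ f(b) (mod d)`. Residues modulo `m` are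
compared modulo `d` through their representatives in `{0, …, m - 1}`; as `d ∣ m`, the choice of
representatives is irrelevant. -/
def CongruencePreserving (n m : ℕ) (f : ZMod n → ZMod m) : Prop :=
  ∀ d : ℕ, d ∣ m → ∀ a b : ℕ, a < n → b < n → a ≡ b [MOD d] →
    (f (a : ZMod n)).val ≡ (f (b : ZMod n)).val [MOD d]

/-- The number of congruence preserving functions `ℤ/nℤ → ℤ/mℤ` (for `n, m ≥ 1` the set of
these functions is finite). -/
noncomputable def CP (n m : ℕ) : ℕ :=
  Nat.card {f : ZMod n → ZMod m // CongruencePreserving n m f}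

/-- The largest prime power dividing `m ≥ 1`, i.e. the maximum of the full prime power factors
`p_i ^ e_i` of `m = p_1 ^ e_1 ⋯ p_r ^ e_r`, with the value `1` at `m = 1`. -/
def largestPrimePower (m : ℕ) : ℕ :=
  max 1 (m.primeFactors.sup fun p => p ^ m.factorization p)

/-! The Chinese remainder theorem reduces the count to `m = p ^ e`. There a function is built one
value at a time. A value at `a` must agree with that at `b < a` modulo each `p ^ j` dividing `a -
b`; such `p ^ j` is at most `a`, so all these conditions follow from a single one modulo `p ^ min e
(log_p a)` (`exists_snoc_iff`). This leaves `p ^ (e - log_p a)` choices, whatever the earlier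
values. Summing exponents over `a < n` and exchanging sums (`sum_range_sub_log`) gives `∑ min n (p ^
k)` over `1 ≤ k ≤ e`, from which both cases are read off. -/

/-- Congruence preservation for functions on `{0, …, n - 1}`, without the detour through `ℤ/nℤ`. -/
def FinCongruencePreserving (n m : ℕ) (g : Fin n → ZMod m) : Prop :=
  ∀ d : ℕ, d ∣ m → ∀ a b : Fin n, (a : ℕ) ≡ b [MOD d] → (g a).val ≡ (g b).val [MOD d]

theorem CP_eq_card_fin {n : ℕ} (m : ℕ) (hn : 1 ≤ n) :
    CP n m = Nat.card {g : Fin n → ZMod m // FinCongruencePreserving n m g} := by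
  obtain ⟨k, rfl⟩ : ∃ k, n = k + 1 := ⟨n - 1, by omega⟩
  refine Nat.card_congr (Equiv.subtypeEquivRight fun f => ?_)
  have key : ∀ a : Fin (k + 1), (((a : ℕ) : ZMod (k + 1))) = a := fun a => Fin.cast_val_eq_self a
  constructor
  · intro h d hd a b hab
    have := h d hd a b a.2 b.2 hab
    rwa [key, key] at this
  · intro h d hd a b ha hb hab
    have := h d hd ⟨a, ha⟩ ⟨b, hb⟩ hab
    rwa [← key ⟨a, ha⟩, ← key ⟨b, hb⟩] at this

theorem ZMod.val_castHom_modEq {m k d : ℕ} [NeZero m] [NeZero k] (hk : k ∣ m) (hd : d ∣ k)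
    (x : ZMod m) : (ZMod.castHom hk (ZMod k) x).val ≡ x.val [MOD d] := by
  refine Nat.ModEq.of_dvd hd ?_
  rw [← ZMod.natCast_eq_natCast_iff, ZMod.natCast_zmod_val, ZMod.castHom_apply, ZMod.cast_eq_val]

/-- A divisor of `a * b` is a product of coprime divisors of `a` and `b`, and a congruence modulo it
is the pair of congruences modulo the factors. -/
theorem congruencePreserving_mul_iff (n : ℕ) {a b : ℕ} [NeZero a] [NeZero b] (hab : a.Coprime b)
    (f : ZMod n → ZMod (a * b)) :
    CongruencePreserving n (a * b) f ↔
      CongruencePreserving n a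
        (fun x => ZMod.castHom (Nat.dvd_mul_right a b) (ZMod a) (f x)) ∧
      CongruencePreserving n b
        (fun x => ZMod.castHom (Nat.dvd_mul_left b a) (ZMod b) (f x)) := by
  constructor
  · refine fun h => ⟨fun d hd x y hx hy hxy => ?_, fun d hd x y hx hy hxy => ?_⟩
    · exact (ZMod.val_castHom_modEq _ hd _).trans
        ((h d (hd.mul_right b) x y hx hy hxy).trans (ZMod.val_castHom_modEq _ hd _).symm)
    · exact (ZMod.val_castHom_modEq _ hd _).trans
        ((h d (hd.mul_left a) x y hx hy hxy).trans (ZMod.val_castHom_modEq _ hd _).symm)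
  · rintro ⟨h₁, h₂⟩ d hd x y hx hy hxy
    obtain ⟨d₁, d₂, hd₁, hd₂, rfl⟩ := (Nat.dvd_mul).1 hd
    rw [← Nat.modEq_and_modEq_iff_modEq_mul (Nat.Coprime.of_dvd hd₁ hd₂ hab)] at hxy ⊢
    exact ⟨(ZMod.val_castHom_modEq _ hd₁ _).symm.trans
        ((h₁ d₁ hd₁ x y hx hy hxy.1).trans (ZMod.val_castHom_modEq _ hd₁ _)),
      (ZMod.val_castHom_modEq _ hd₂ _).symm.trans
        ((h₂ d₂ hd₂ x y hx hy hxy.2).trans (ZMod.val_castHom_modEq _ hd₂ _))⟩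

theorem CP_mul_of_coprime (n : ℕ) {a b : ℕ} [NeZero a] [NeZero b] (hab : a.Coprime b) :
    CP n (a * b) = CP n a * CP n b := by
  unfold CP
  rw [← Nat.card_prod]
  let E : (ZMod n → ZMod (a * b)) ≃ (ZMod n → ZMod a) × (ZMod n → ZMod b) :=
    (Equiv.arrowCongr (Equiv.refl _) (ZMod.chineseRemainder hab).toEquiv).trans
      (Equiv.arrowProdEquivProdArrow _ _ _)
  refine Nat.card_congr ((E.subtypeEquiv (q := fun F =>
    CongruencePreserving n a F.1 ∧ CongruencePreserving n b F.2) fun f => ?_).trans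
    Equiv.subtypeProdEquivProd)
  rw [congruencePreserving_mul_iff n hab]
  -- Ring homomorphisms out of `ZMod (a * b)` are unique, so the components of the Chinese remainder
  -- map are the casts.
  have h₁ : (E f).1 = fun x => ZMod.castHom (Nat.dvd_mul_right a b) (ZMod a) (f x) := by
    funext x
    exact RingHom.congr_fun (Subsingleton.elim ((RingHom.fst _ _).comp
      (ZMod.chineseRemainder hab).toRingHom) (ZMod.castHom (Nat.dvd_mul_right a b) (ZMod a))) (f x)
  have h₂ : (E f).2 = fun x => ZMod.castHom (Nat.dvd_mul_left b a) (ZMod b) (f x) := by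
    funext x
    exact RingHom.congr_fun (Subsingleton.elim ((RingHom.snd _ _).comp
      (ZMod.chineseRemainder hab).toRingHom) (ZMod.castHom (Nat.dvd_mul_left b a) (ZMod b))) (f x)
  rw [h₁, h₂]

theorem CP_one (n : ℕ) : CP n 1 = 1 := by
  have : Unique {f : ZMod n → ZMod 1 // CongruencePreserving n 1 f} :=
    { default := ⟨fun _ => 0, fun _ _ _ _ _ _ _ => rfl⟩
      uniq := fun f => Subtype.ext (Subsingleton.elim (α := ZMod n → Fin 1) _ _) }
  exact Nat.card_unique

theorem CP_eq_prod_primeFactors (n : ℕ) {m : ℕ} (hm : m ≠ 0) :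
    CP n m = ∏ p ∈ m.primeFactors, CP n (p ^ m.factorization p) := by
  induction m using Nat.recOnPosPrimePosCoprime with
  | zero => exact absurd rfl hm
  | one => simp [CP_one]
  | prime_pow p k hp hk =>
    rw [Nat.primeFactors_prime_pow hk.ne' hp, Finset.prod_singleton, hp.factorization_pow,
      Finsupp.single_eq_same]
  | coprime a b ha hb hab iha ihb =>
    have : NeZero a := ⟨by omega⟩
    have : NeZero b := ⟨by omega⟩
    rw [CP_mul_of_coprime n hab, iha (NeZero.ne a), ihb (NeZero.ne b), hab.primeFactors_mul,
      Finset.prod_union hab.disjoint_primeFactors]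
    congr 1
    · exact Finset.prod_congr rfl fun p hp => by
        rw [Nat.factorization_eq_of_coprime_left hab (by simpa using hp)]
    · exact Finset.prod_congr rfl fun p hp => by
        rw [Nat.factorization_eq_of_coprime_right hab (by simpa using hp)]

theorem ZMod.card_val_modEq {q d : ℕ} [NeZero q] (hd : d ∣ q) (c : ℕ) :
    Nat.card {x : ZMod q // x.val ≡ c [MOD d]} = q / d := by
  have hd0 : 0 < d := Nat.pos_of_dvd_of_pos hd (NeZero.pos q)
  have h := Nat.count_modEq_card q hd0 c
  rw [Nat.mod_eq_zero_of_dvd hd, if_neg (Nat.not_lt_zero _), add_zero,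
    Nat.count_eq_card_filter_range] at h
  rw [← h, ← Nat.card_eq_finsetCard]
  exact Nat.card_congr
    { toFun := fun x => ⟨x.1.val, by simpa using ⟨ZMod.val_lt x.1, x.2⟩⟩
      invFun := fun i => ⟨(i.1 : ZMod q), by
        have := Finset.mem_filter.1 i.2
        rw [ZMod.val_cast_of_lt (Finset.mem_range.1 this.1)]
        exact this.2⟩
      left_inv := fun x => Subtype.ext (ZMod.natCast_zmod_val x.1)
      right_inv := fun i => Subtype.ext
        (ZMod.val_cast_of_lt (Finset.mem_range.1 (Finset.mem_filter.1 i.2).1)) }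

/-- The extension of a congruence preserving function on `{0, …, n - 1}` to `n` is subject to a
single congruence, modulo the largest power `p ^ k ≤ n` dividing `p ^ e`. -/
theorem FinCongruencePreserving.exists_snoc_iff {p e n : ℕ} (hp : p.Prime)
    {h : Fin n → ZMod (p ^ e)} (hh : FinCongruencePreserving n (p ^ e) h) :
    ∃ c : ℕ, ∀ x : ZMod (p ^ e),
      FinCongruencePreserving (n + 1) (p ^ e) (Fin.snoc (α := fun _ => ZMod (p ^ e)) h x) ↔
        x.val ≡ c [MOD p ^ min e (Nat.log p n)] := by
  rcases Nat.eq_zero_or_pos n with rfl | hn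
  · refine ⟨0, fun x => iff_of_true ?_ (by simp [Nat.modEq_one])⟩
    intro d _ a b _
    rw [Subsingleton.elim (α := Fin 1) a b]
  set k := min e (Nat.log p n) with hk
  have hkn : p ^ k ≤ n :=
    (Nat.pow_le_pow_right hp.pos (min_le_right _ _)).trans (Nat.pow_log_le_self p hn.ne')
  -- An earlier point congruent to `n` modulo `p ^ k`; its value fixes the residue class `c`.
  let r : Fin n := ⟨n % p ^ k, (Nat.mod_lt _ (pow_pos hp.pos k)).trans_le hkn⟩
  have hr : (r : ℕ) ≡ n [MOD p ^ k] := Nat.mod_modEq _ _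
  refine ⟨(h r).val, fun x => ⟨fun H => ?_, fun hx => ?_⟩⟩
  · have := H (p ^ k) (pow_dvd_pow p (min_le_left _ _)) (Fin.last n) r.castSucc
      (by simpa using hr.symm)
    simpa using this
  · have last : ∀ d, d ∣ p ^ e → ∀ b : Fin n, n ≡ b [MOD d] → x.val ≡ (h b).val [MOD d] := by
      intro d hd b hb
      -- `p ^ j` divides `n - b`, which is positive and at most `n`, so `j ≤ log_p n`.
      have hdk : d ∣ p ^ k := by
        obtain ⟨j, hj, rfl⟩ := (Nat.dvd_prime_pow hp).1 hd
        refine pow_dvd_pow p (le_min hj (Nat.le_log_of_pow_le hp.one_lt ?_))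
        have : p ^ j ∣ n - b := (Nat.modEq_iff_dvd' b.2.le).1 hb.symm
        exact (Nat.le_of_dvd (by omega) this).trans (Nat.sub_le _ _)
      exact (hx.of_dvd hdk).trans (hh d hd r b ((hr.of_dvd hdk).trans hb))
    intro d hd a b hab
    induction a using Fin.lastCases with
    | last =>
      induction b using Fin.lastCases with
      | last => rfl
      | cast b => simpa using last d hd b (by simpa using hab)
    | cast a =>
      induction b using Fin.lastCases with
      | last => simpa using (last d hd a (by simpa using hab.symm)).symm
      | cast b => simpa using hh d hd a b (by simpa using hab)

theorem FinCongruencePreserving.init {n m : ℕ} {g : Fin (n + 1) → ZMod m}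
    (hg : FinCongruencePreserving (n + 1) m g) :
    FinCongruencePreserving n m (fun i => g i.castSucc) :=
  fun d hd a b hab => hg d hd a.castSucc b.castSucc (by simpa using hab)

/-- A congruence preserving function on `{0, …, n}` is a congruence preserving function on
`{0, …, n - 1}` together with an admissible value at `n`. -/
def finCongruencePreservingSuccEquiv (n m : ℕ) :
    {g : Fin (n + 1) → ZMod m // FinCongruencePreserving (n + 1) m g} ≃
      Σ h : {h : Fin n → ZMod m // FinCongruencePreserving n m h},
        {x : ZMod m // FinCongruencePreserving (n + 1) m
          (Fin.snoc (α := fun _ => ZMod m) h.1 x)} where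
  toFun g := ⟨⟨fun i => g.1 i.castSucc, g.2.init⟩, ⟨g.1 (Fin.last n), by
    have : (Fin.snoc (α := fun _ => ZMod m) (fun i => g.1 i.castSucc) (g.1 (Fin.last n))) = g.1 :=
      Fin.snoc_init_self g.1
    simpa only [this] using g.2⟩⟩
  invFun s := ⟨_, s.2.2⟩
  left_inv g := Subtype.ext (Fin.snoc_init_self g.1)
  right_inv := by
    rintro ⟨⟨h, hh⟩, ⟨x, hx⟩⟩
    have e₁ : (fun i : Fin n => (Fin.snoc (α := fun _ => ZMod m) h x : Fin (n + 1) → ZMod m)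
        i.castSucc) = h := by funext i; simp
    refine Sigma.ext (Subtype.ext e₁) ?_
    refine (Subtype.heq_iff_coe_eq fun y => ?_).2 (by simp)
    simp only [e₁]

/-- The truncated subtraction is intended: once `p ^ e ≤ a`, the earlier values force the value at
`a`. -/
theorem card_finCongruencePreserving_prime_pow {p : ℕ} (hp : p.Prime) (e n : ℕ) :
    Nat.card {g : Fin n → ZMod (p ^ e) // FinCongruencePreserving n (p ^ e) g} =
      p ^ ∑ a ∈ Finset.range n, (e - Nat.log p a) := by
  have : NeZero (p ^ e) := ⟨(pow_pos hp.pos e).ne'⟩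
  induction n with
  | zero =>
    have : Unique {g : Fin 0 → ZMod (p ^ e) // FinCongruencePreserving 0 (p ^ e) g} :=
      { default := ⟨Fin.elim0, fun _ _ a => a.elim0⟩
        uniq := fun f => Subtype.ext (Subsingleton.elim _ _) }
    simp
  | succ n ih =>
    classical
    have hfib : ∀ h : {h : Fin n → ZMod (p ^ e) // FinCongruencePreserving n (p ^ e) h},
        Nat.card {x : ZMod (p ^ e) // FinCongruencePreserving (n + 1) (p ^ e)
          (Fin.snoc (α := fun _ => ZMod (p ^ e)) h.1 x)} = p ^ (e - Nat.log p n) := by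
      intro h
      obtain ⟨c, hc⟩ := h.2.exists_snoc_iff hp
      rw [Nat.card_congr (Equiv.subtypeEquivRight hc),
        ZMod.card_val_modEq (pow_dvd_pow p (min_le_left _ _)),
        Nat.pow_div (min_le_left _ _) hp.pos]
      congr 1
      omega
    have := Fintype.ofFinite {h : Fin n → ZMod (p ^ e) // FinCongruencePreserving n (p ^ e) h}
    rw [Nat.card_congr (finCongruencePreservingSuccEquiv n (p ^ e)), Nat.card_sigma,
      Finset.sum_congr rfl fun h _ => hfib h, Finset.sum_const, Finset.card_univ,
      ← Nat.card_eq_fintype_card, ih, smul_eq_mul, ← pow_add, Finset.sum_range_succ]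

/-- Double count of the pairs `(a, k)` with `a < n`, `1 ≤ k ≤ e` and `a < p ^ k`. -/
theorem sum_range_sub_log {p : ℕ} (hp : 1 < p) (e n : ℕ) :
    ∑ a ∈ Finset.range n, (e - Nat.log p a) = ∑ k ∈ Finset.Icc 1 e, min n (p ^ k) := by
  have h : ∀ a, e - Nat.log p a = ∑ k ∈ Finset.Icc 1 e, if a < p ^ k then 1 else 0 := by
    intro a
    rw [← Finset.card_filter, ← Nat.card_Ioc]
    congr 1
    ext k
    simp only [Finset.mem_Ioc, Finset.mem_filter, Finset.mem_Icc]
    constructor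
    · exact fun ⟨h₁, h₂⟩ => ⟨⟨by omega, h₂⟩, Nat.lt_pow_of_log_lt hp h₁⟩
    -- `1 ≤ k` is what covers `a = 0`, where the logarithm is `0`.
    · exact fun ⟨⟨h₁, h₂⟩, h₃⟩ => ⟨Nat.log_lt_of_lt_pow' (by omega) h₃, h₂⟩
  simp_rw [h]
  rw [Finset.sum_comm]
  refine Finset.sum_congr rfl fun k _ => ?_
  rw [← Finset.card_filter, ← Finset.card_range (min n (p ^ k))]
  congr 1
  ext a
  simp

theorem CP_prime_pow {p n : ℕ} (hp : p.Prime) (hn : 1 ≤ n) (e : ℕ) :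
    CP n (p ^ e) = p ^ ∑ k ∈ Finset.Icc 1 e, min n (p ^ k) := by
  rw [CP_eq_card_fin _ hn, card_finCongruencePreserving_prime_pow hp, sum_range_sub_log hp.one_lt]

theorem CP_prime_pow_of_le {p e n : ℕ} (hp : p.Prime) (hn : 1 ≤ n) (h : p ^ e ≤ n) :
    CP n (p ^ e) = p ^ ∑ k ∈ Finset.Icc 1 e, p ^ k := by
  rw [CP_prime_pow hp hn]
  congr 1
  refine Finset.sum_congr rfl fun k hk => min_eq_right ?_
  exact (Nat.pow_le_pow_right hp.pos (Finset.mem_Icc.1 hk).2).trans h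

theorem CP_prime_pow_of_lt {p e n : ℕ} (hp : p.Prime) (hn : 1 ≤ n) (h : n < p ^ e) :
    CP n (p ^ e) =
      p ^ ((∑ k ∈ Finset.Icc 1 (Nat.log p n), p ^ k) + (e - Nat.log p n) * n) := by
  have hl : Nat.log p n ≤ e := (Nat.log_lt_of_lt_pow (by omega) h).le
  rw [CP_prime_pow hp hn]
  congr 1
  have hIcc : ∀ j, Finset.Icc 1 j = Finset.Ioc 0 j := fun j => rfl
  -- Split at `log_p n`: up to it the minimum is `p ^ k`, beyond it `n`.
  rw [hIcc, hIcc, ← Finset.sum_Ioc_consecutive _ (Nat.zero_le _) hl]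
  congr 1
  · refine Finset.sum_congr rfl fun k hk => min_eq_right ?_
    exact Nat.pow_le_of_le_log (by omega) (Finset.mem_Ioc.1 hk).2
  · rw [Finset.sum_congr rfl fun k hk => min_eq_left
      (Nat.lt_pow_of_log_lt hp.one_lt (Finset.mem_Ioc.1 hk).1).le]
    simp

theorem proposition4p1 (n m : ℕ) (hn : 1 ≤ n) (hm : 1 ≤ m) :
    -- multiplicativity over the prime power factors of `m`
    (CP n m = ∏ p ∈ m.primeFactors, CP n (p ^ m.factorization p)) ∧
    -- the value at a prime power; in the second case `Nat.log p n < e`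
    (∀ p e : ℕ, p.Prime →
      (p ^ e ≤ n → CP n (p ^ e) = p ^ (∑ k ∈ Finset.Icc 1 e, p ^ k)) ∧
      (n < p ^ e →
        CP n (p ^ e) =
          p ^ ((∑ k ∈ Finset.Icc 1 (Nat.log p n), p ^ k) + (e - Nat.log p n) * n))) ∧
    -- the explicit formula when `n` is at least the largest prime power dividing `m`
    (largestPrimePower m ≤ n →
      CP n m = ∏ p ∈ m.primeFactors, p ^ (∑ k ∈ Finset.Icc 1 (m.factorization p), p ^ k)) ∧
    -- the explicit formula when `n` is less than the largest prime power dividing `m`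
    (n < largestPrimePower m →
      CP n m =
        (∏ p ∈ m.primeFactors with p ^ m.factorization p ≤ n,
          p ^ (∑ k ∈ Finset.Icc 1 (m.factorization p), p ^ k)) *
        ∏ p ∈ m.primeFactors with n < p ^ m.factorization p,
          p ^ ((∑ k ∈ Finset.Icc 1 (Nat.log p n), p ^ k) +
            (m.factorization p - Nat.log p n) * n)) := by
  have hprod := CP_eq_prod_primeFactors n (m := m) (by omega)
  refine ⟨hprod, fun p e hp => ⟨CP_prime_pow_of_le hp hn, CP_prime_pow_of_lt hp hn⟩, fun h => ?_,
    fun _ => ?_⟩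
  · rw [hprod]
    refine Finset.prod_congr rfl fun p hp =>
      CP_prime_pow_of_le (Nat.prime_of_mem_primeFactors hp) hn ?_
    exact ((Finset.le_sup (f := fun p => p ^ m.factorization p) hp).trans
      (le_max_right _ _)).trans h
  · rw [hprod, ← Finset.prod_filter_mul_prod_filter_not m.primeFactors
      (fun p => p ^ m.factorization p ≤ n)]
    simp_rw [not_le]
    congr 1 <;> refine Finset.prod_congr rfl fun p hp => ?_ <;> rw [Finset.mem_filter] at hp
    · exact CP_prime_pow_of_le (Nat.prime_of_mem_primeFactors hp.1) hn hp.2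
    · exact CP_prime_pow_of_lt (Nat.prime_of_mem_primeFactors hp.1) hn hp.2
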